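/- For $\theta=(\alpha,\beta)\in(0,\infty)^2$ let $\nu_\theta$ be the Beta$(\alpha,\beta)$ distribution on $(0,1)$, and let $\Theta$ be a compact subset of $\{(\alpha,\beta)\in(0,\infty)^2:\alpha>\beta+1\}$. For $x,y\in\mathbb{Z}_+$ put $$\phi_\theta(x,y)=\log\int_0^1 a^{x+1}(1-a)^y\,\mathrm{d}\nu_\theta(a),\qquad Q_\theta(x,y)=\binom{x+y}{x}\mathrm{e}^{\phi_\theta(x,y)}.$$ For every $\theta\in\Theta$ the transition kernel $Q_\theta$ on $\mathbb{Z}_+$ has a unique stationary probability distribution $\pi_\theta$. Put $\tilde\pi_\theta(g)=\sum_{x,y\in\mathbb{Z}_+}\pi_\theta(x)Q_\theta(x,y)g(x,y)$ for $g\ge 0$; denote by a dot and two dots the gradient and the Hessian matrix with respect to $\theta$, and by $\|\cdot\|$ the uniform norm (largest absolute value of an entry). Then: (Assumption 2, differentiability) for all $(x,y)\in\mathbb{Z}_+^2$, the map $\theta\mapsto\phi_\theta(x,y)$ is twice continuously differentiable on $\Theta$ (on a neighbourhood in $\mathbb{R}^2$ of each point of $\Theta$); (Assumption 3, regularity) for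 every $\theta\in\Theta$ there is some $q>1$ such that $\tilde\pi_\theta\big(\|\dot\phi_\theta\|^{2q}\big)<\infty$, and for every $\theta\in\Theta$ and $x\in\mathbb{Z}_+$, $$\sum_{y\in\mathbb{Z}_+}\dot Q_\theta(x,y)=\partial_\theta\sum_{y\in\mathbb{Z}_+}Q_\theta(x,y)=0,$$ where the first series converges absolutely; (Assumption 4, uniformity) every $\theta\in\Theta$ has a neighbourhood $\mathcal V(\theta)\subset(0,\infty)^2$ such that $$\tilde\pi_\theta\Big(\sup_{\theta'\in\mathcal V(\theta)}\|\dot\phi_{\theta'}\|^2\Big)<\infty\quad\text{and}\quad\tilde\pi_\theta\Big(\sup_{\theta'\in\mathcal V(\theta)}\|\ddot\phi_{\theta'}\|\Big)<\infty.$$ -/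

import Mathlib

open MeasureTheory Filter Topology
open scoped ENNReal

noncomputable section

namespace RWRE

/-- Parameters in `ℝ^d`, with the uniform norm. -/
abbrev Param (d : ℕ) : Type := Fin d → ℝ

/-- The gradient (vector of partial derivatives) of a real function of the parameter. -/
def grad {d : ℕ} (f : Param d → ℝ) (θ : Param d) : Fin d → ℝ :=
  fun i => fderiv ℝ f θ (Pi.single i 1)

/-- The Hessian (array of second partial derivatives) of a real function of the parameter;
its norm is the largest absolute value of an entry. -/
def hess {d : ℕ} (f : Param d → ℝ) (θ : Param d) : Fin d → Fin d → ℝ :=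
  fun i j => grad (fun θ' => grad f θ' j) θ i

/-- `∫₀¹ a^(x+1) (1-a)^y dν_θ(a)`, for a family `ν` of laws on `(0,1)`. -/
def envMoment {d : ℕ} (ν : Param d → Measure ℝ) (θ : Param d) (x y : ℕ) : ℝ :=
  ∫ a in Set.Ioo (0 : ℝ) 1, a ^ (x + 1) * (1 - a) ^ y ∂(ν θ)

/-- `φ_θ(x,y) = log ∫₀¹ a^(x+1) (1-a)^y dν_θ(a)`. -/
def phi {d : ℕ} (ν : Param d → Measure ℝ) (θ : Param d) (x y : ℕ) : ℝ :=
  Real.log (envMoment ν θ x y)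

/-- `Q_θ(x,y) = C(x+y,x) ∫₀¹ a^(x+1) (1-a)^y dν_θ(a)`, the transition kernel of the branching
process with immigration in random environment. -/
def Q {d : ℕ} (ν : Param d → Measure ℝ) (θ : Param d) (x y : ℕ) : ℝ :=
  ((x + y).choose x : ℝ) * envMoment ν θ x y

/-- `p` is a stationary probability distribution on `ℕ` of the kernel `K`. -/
structure IsStationaryDist (K : ℕ → ℕ → ℝ) (p : ℕ → ℝ) : Prop where
  nonneg : ∀ x, 0 ≤ p x
  hasSum_one : HasSum p 1
  invariant : ∀ y, HasSum (fun x => p x * K x y) (p y)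

/-- `p` is the unique stationary probability distribution of the kernel `K`. -/
def IsTheStationaryDist (K : ℕ → ℕ → ℝ) (p : ℕ → ℝ) : Prop :=
  IsStationaryDist K p ∧ ∀ p', IsStationaryDist K p' → p' = p

/-- `π̃(g) = ∑_{x,y} p(x) K(x,y) g(x,y)`, for `g ≥ 0`, as a number in `[0,∞]`. -/
def pairSum (p : ℕ → ℝ) (K : ℕ → ℕ → ℝ) (g : ℕ → ℕ → ℝ≥0∞) : ℝ≥0∞ :=
  ∑' x, ∑' y, ENNReal.ofReal (p x * K x y) * g x y

/-- Differentiability: for all `x, y`, the map `θ ↦ φ_θ(x,y)` is twice continuously differentiable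
on `Θ` (that is, around every point of `Θ`). -/
def Differentiability {d : ℕ} (ν : Param d → Measure ℝ) (Θ : Set (Param d)) : Prop :=
  ∀ x y : ℕ, ∀ θ ∈ Θ, ContDiffAt ℝ 2 (fun θ' => phi ν θ' x y) θ

/-- Regularity conditions, `π θ` being the stationary distribution of `Q_θ`:
`π̃_θ(‖φ̇_θ‖^(2q)) < ∞` for some `q > 1`, and
`∑_y Q̇_θ(x,y) = ∂_θ ∑_y Q_θ(x,y) = 0` for every `x`. -/
def Regularity {d : ℕ} (ν : Param d → Measure ℝ) (π : Param d → ℕ → ℝ)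
    (Θ : Set (Param d)) : Prop :=
  (∀ θ ∈ Θ, ∃ q : ℝ, 1 < q ∧
    pairSum (π θ) (Q ν θ) (fun x y => ‖grad (fun θ' => phi ν θ' x y) θ‖ₑ ^ (2 * q)) < ∞) ∧
  (∀ θ ∈ Θ, ∀ x : ℕ,
    (∀ y : ℕ, DifferentiableAt ℝ (fun θ' => Q ν θ' x y) θ) ∧
    HasSum (fun y : ℕ => grad (fun θ' => Q ν θ' x y) θ) 0 ∧
    (∀ᶠ θ' in 𝓝 θ, Summable (fun y : ℕ => Q ν θ' x y)) ∧
    HasFDerivAt (fun θ' => ∑' y : ℕ, Q ν θ' x y) (0 : Param d →L[ℝ] ℝ) θ)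

/-- Uniform conditions, `π θ` being the stationary distribution of `Q_θ`: every `θ ∈ Θ` has a
neighbourhood `V`, on which the derivatives exist, with `π̃_θ(sup_{θ' ∈ V} ‖φ̇_θ'‖²) < ∞` and
`π̃_θ(sup_{θ' ∈ V} ‖φ̈_θ'‖) < ∞`. -/
def Uniformity {d : ℕ} (ν : Param d → Measure ℝ) (π : Param d → ℕ → ℝ)
    (Θ : Set (Param d)) : Prop :=
  ∀ θ ∈ Θ, ∃ V ∈ 𝓝 θ,
    (∀ θ' ∈ V, ∀ x y : ℕ, ContDiffAt ℝ 2 (fun η => phi ν η x y) θ') ∧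
    pairSum (π θ) (Q ν θ)
      (fun x y => ⨆ θ' ∈ V, ‖grad (fun η => phi ν η x y) θ'‖ₑ ^ 2) < ∞ ∧
    pairSum (π θ) (Q ν θ)
      (fun x y => ⨆ θ' ∈ V, ‖hess (fun η => phi ν η x y) θ'‖ₑ) < ∞

/-- The Beta environment: `θ = (α, β)` and `ν_θ` is the Beta distribution `Beta(α, β)`. -/
def betaEnv (θ : Param 2) : Measure ℝ := ProbabilityTheory.betaMeasure (θ 0) (θ 1)

end RWRE

end

/-! Everything is explicit in Beta functions: Q_θ(x,y) = C(x+y,x) B(α+x+1, β+y) / B(α,β).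
Integrating the negative binomial series gives `hasSum_choose_mul_beta`, the source of every sum
below. The law `statDist` is reversible for Q_θ (`statDist_detailed_balance`), and positivity of Q_θ
makes it the only stationary law. Its mean is finite because α > β + 1; by reversibility both
coordinates of the pair law have this mean, so any g = O(1+x+y) has a finite π̃_θ-sum
(`pairSum_lt_top_of_le`).

It remains to bound derivatives. φ_θ is a combination of increments of log Γ, so its gradient and
Hessian are combinations of increments of ψ = (log Γ)' and of ψ'. Since ψ(t+1) = ψ(t) + 1/t, these
grow at most like harmonic numbers, hence are O((1+x+y)^(1/4)) uniformly on boxes of parameters.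
Even the fourth power of the gradient is then O(1+x+y), so q = 2 works. Finally, the rows of Q_θ sum
to 1, and a summable bound on a box, available since α > 1, permits termwise differentiation. -/

namespace RWRE

open ProbabilityTheory (beta beta_pos)

/-! ### Beta integrals and a binomial series -/

theorem beta_comm (u v : ℝ) : beta u v = beta v u := by
  simp only [beta, mul_comm, add_comm]

theorem ofReal_beta_eq_lintegral {u v : ℝ} (hu : 0 < u) (hv : 0 < v) :
    ENNReal.ofReal (beta u v) =
      ∫⁻ t in Set.Ioo (0 : ℝ) 1, ENNReal.ofReal (t ^ (u - 1) * (1 - t) ^ (v - 1)) := by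
  have hb := beta_pos hu hv
  have h := ProbabilityTheory.lintegral_betaPDF_eq_one hu hv
  rw [ProbabilityTheory.lintegral_betaPDF] at h
  have h2 : ∀ t : ℝ, ENNReal.ofReal (1 / beta u v * t ^ (u - 1) * (1 - t) ^ (v - 1)) =
      ENNReal.ofReal (1 / beta u v) * ENNReal.ofReal (t ^ (u - 1) * (1 - t) ^ (v - 1)) := by
    intro t
    rw [mul_assoc, ENNReal.ofReal_mul (by positivity)]
  simp_rw [h2] at h
  rw [lintegral_const_mul' _ _ ENNReal.ofReal_ne_top] at h
  calc ENNReal.ofReal (beta u v) = ENNReal.ofReal (beta u v) * 1 := (mul_one _).symm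
    _ = _ := by
      rw [← h, ← mul_assoc, ← ENNReal.ofReal_mul hb.le, mul_one_div_cancel hb.ne',
        ENNReal.ofReal_one, one_mul]

theorem beta_le_beta {u v u' v' : ℝ} (hu : 0 < u) (hv : 0 < v) (huu : u ≤ u') (hvv : v ≤ v') :
    beta u' v' ≤ beta u v := by
  rw [← ENNReal.ofReal_le_ofReal_iff (beta_pos hu hv).le, ofReal_beta_eq_lintegral hu hv,
    ofReal_beta_eq_lintegral (hu.trans_le huu) (hv.trans_le hvv)]
  refine setLIntegral_mono' measurableSet_Ioo fun t ht => ENNReal.ofReal_le_ofReal ?_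
  have h1 : 0 < 1 - t := by linarith [ht.2]
  have h2 : 0 < t := ht.1
  apply mul_le_mul
  · exact Real.rpow_le_rpow_of_exponent_ge h2 ht.2.le (by linarith)
  · exact Real.rpow_le_rpow_of_exponent_ge h1 (by linarith) (by linarith)
  · positivity
  · positivity

theorem hasSum_of_eq {f g : ℕ → ℝ} {s : ℝ} (h : ∀ n, f n = g n) (hg : HasSum g s) :
    HasSum f s :=
  funext h ▸ hg

theorem hasSum_of_tsum_ofReal {f : ℕ → ℝ} {s : ℝ} (hf : ∀ n, 0 ≤ f n) (hs : 0 ≤ s)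
    (h : ∑' n, ENNReal.ofReal (f n) = ENNReal.ofReal s) : HasSum f s := by
  have h1 := ENNReal.hasSum_toReal (f := fun n => ENNReal.ofReal (f n))
    (by rw [h]; exact ENNReal.ofReal_ne_top)
  rw [← ENNReal.tsum_toReal_eq (fun _ => ENNReal.ofReal_ne_top), h, ENNReal.toReal_ofReal hs] at h1
  simpa only [ENNReal.toReal_ofReal (hf _)] using h1

/-- Integrate ∑ C(m+y,m) t^y = (1-t)^(-(m+1)) against t^(b-1) (1-t)^(c+m); all terms are
nonnegative, so sum and integral commute in `ℝ≥0∞`. -/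
theorem hasSum_choose_mul_beta (m : ℕ) {b c : ℝ} (hb : 0 < b) (hc : 0 < c) :
    HasSum (fun y : ℕ => ((m + y).choose m : ℝ) * beta (b + y) (c + m + 1)) (beta b c) := by
  have hpos : ∀ y : ℕ, 0 < beta (b + y) (c + m + 1) := fun y => beta_pos (by positivity)
    (by positivity)
  refine hasSum_of_tsum_ofReal (fun y => mul_nonneg (by positivity) (hpos y).le)
    (beta_pos hb hc).le ?_
  rw [ofReal_beta_eq_lintegral hb hc]
  have key : ∀ y : ℕ, ENNReal.ofReal (((m + y).choose m : ℝ) * beta (b + y) (c + m + 1)) =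
      ∫⁻ t in Set.Ioo (0 : ℝ) 1, ENNReal.ofReal (((m + y).choose m : ℝ) *
        (t ^ (b + y - 1) * (1 - t) ^ (c + m + 1 - 1))) := by
    intro y
    rw [ENNReal.ofReal_mul (by positivity), ofReal_beta_eq_lintegral (by positivity)
      (by positivity), ← lintegral_const_mul' _ _ ENNReal.ofReal_ne_top]
    exact lintegral_congr fun t => (ENNReal.ofReal_mul (Nat.cast_nonneg _)).symm
  simp_rw [key]
  rw [← lintegral_tsum (fun y => Measurable.aemeasurable (by fun_prop))]
  refine setLIntegral_congr_fun measurableSet_Ioo fun t ht => ?_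
  have h2 : 0 < t := ht.1
  have h1 : 0 < 1 - t := by linarith [ht.2]
  have hs : HasSum (fun y : ℕ => ((m + y).choose m : ℝ) *
      (t ^ (b + y - 1) * (1 - t) ^ (c + m + 1 - 1))) (t ^ (b - 1) * (1 - t) ^ (c - 1)) := by
    have h := hasSum_choose_mul_geometric_of_norm_lt_one m
      (show ‖t‖ < 1 by rw [Real.norm_eq_abs, abs_of_pos h2]; exact ht.2)
    have h' := h.mul_left (t ^ (b - 1) * (1 - t) ^ (c + m + 1 - 1))
    have e : t ^ (b - 1) * (1 - t) ^ (c + m + 1 - 1) * (1 / (1 - t) ^ (m + 1)) =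
        t ^ (b - 1) * (1 - t) ^ (c - 1) := by
      rw [show c + (m : ℝ) + 1 - 1 = (c - 1) + ((m + 1 : ℕ) : ℝ) by push_cast; ring,
        Real.rpow_add_natCast h1.ne']
      field_simp
    rw [e] at h'
    refine (hasSum_of_eq fun y => ?_) h'
    rw [show b + (y : ℝ) - 1 = (b - 1) + y by ring, Real.rpow_add_natCast h2.ne', add_comm m y]
    ring
  rw [← hs.tsum_eq, ENNReal.ofReal_tsum_of_nonneg (fun y => by positivity) hs.summable]

/-! ### The kernel and its unique, reversible stationary law -/

theorem envMoment_betaEnv {θ : Param 2} (h0 : 0 < θ 0) (h1 : 0 < θ 1) (x y : ℕ) :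
    envMoment betaEnv θ x y = beta (θ 0 + x + 1) (θ 1 + y) / beta (θ 0) (θ 1) := by
  have hb := beta_pos h0 h1
  have hb' : 0 < beta (θ 0 + x + 1) (θ 1 + y) := beta_pos (by positivity) (by positivity)
  rw [envMoment, integral_eq_lintegral_of_nonneg_ae, betaEnv, ProbabilityTheory.betaMeasure,
    restrict_withDensity measurableSet_Ioo, lintegral_withDensity_eq_lintegral_mul]
  · rw [← ENNReal.toReal_ofReal (div_nonneg hb'.le hb.le), div_eq_inv_mul, ENNReal.ofReal_mul
      (by positivity), ofReal_beta_eq_lintegral (u := θ 0 + x + 1) (by positivity) (by positivity),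
      ← lintegral_const_mul' _ _ ENNReal.ofReal_ne_top]
    congr 1
    refine setLIntegral_congr_fun measurableSet_Ioo fun t ht => ?_
    have h2 : 0 < t := ht.1
    have h1 : 0 < 1 - t := by linarith [ht.2]
    rw [Pi.mul_apply, ProbabilityTheory.betaPDF_of_pos_lt_one ht.1 ht.2,
      ← ENNReal.ofReal_mul (by positivity), ← ENNReal.ofReal_mul (by positivity)]
    congr 1
    rw [show θ 0 + (x : ℝ) + 1 - 1 = (θ 0 - 1) + ((x + 1 : ℕ) : ℝ) by push_cast; ring,
      Real.rpow_add_natCast h2.ne', show θ 1 + (y : ℝ) - 1 = (θ 1 - 1) + y by ring,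
      Real.rpow_add_natCast h1.ne']
    ring
  · exact (ProbabilityTheory.measurable_betaPDFReal _ _).ennreal_ofReal
  · fun_prop
  · refine ae_restrict_of_forall_mem measurableSet_Ioo fun t ht => ?_
    have h2 : 0 < t := ht.1
    have h1 : 0 < 1 - t := by linarith [ht.2]
    simp only [Pi.zero_apply]
    positivity
  · exact Measurable.aestronglyMeasurable (by fun_prop)

theorem Q_betaEnv {θ : Param 2} (h0 : 0 < θ 0) (h1 : 0 < θ 1) (x y : ℕ) :
    Q betaEnv θ x y =
      ((x + y).choose x : ℝ) * (beta (θ 0 + x + 1) (θ 1 + y) / beta (θ 0) (θ 1)) := by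
  rw [Q, envMoment_betaEnv h0 h1]

theorem envMoment_pos {θ : Param 2} (h0 : 0 < θ 0) (h1 : 0 < θ 1) (x y : ℕ) :
    0 < envMoment betaEnv θ x y := by
  rw [envMoment_betaEnv h0 h1]
  exact div_pos (beta_pos (by positivity) (by positivity)) (beta_pos h0 h1)

theorem Q_pos {θ : Param 2} (h0 : 0 < θ 0) (h1 : 0 < θ 1) (x y : ℕ) :
    0 < Q betaEnv θ x y :=
  mul_pos (by exact_mod_cast Nat.choose_pos (Nat.le_add_right x y)) (envMoment_pos h0 h1 x y)

theorem hasSum_Q {θ : Param 2} (h0 : 0 < θ 0) (h1 : 0 < θ 1) (x : ℕ) :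
    HasSum (Q betaEnv θ x) 1 := by
  have h := (hasSum_choose_mul_beta x h1 h0).div_const (beta (θ 0) (θ 1))
  rw [beta_comm (θ 1), div_self (beta_pos h0 h1).ne'] at h
  refine (hasSum_of_eq fun y => ?_) h
  rw [Q_betaEnv h0 h1, beta_comm (θ 1 + y), mul_div_assoc]

/-- The law on `ℕ` of a geometric variable with `Beta(α - β, β)`-distributed success parameter. -/
noncomputable def statDist (θ : Param 2) (k : ℕ) : ℝ :=
  beta (θ 1 + k) (θ 0 - θ 1 + 1) / beta (θ 1) (θ 0 - θ 1)

theorem statDist_nonneg {θ : Param 2} (h1 : 0 < θ 1) (h : θ 1 + 1 < θ 0) (k : ℕ) :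
    0 ≤ statDist θ k :=
  div_nonneg (beta_pos (by positivity) (by linarith)).le (beta_pos h1 (by linarith)).le

theorem hasSum_statDist {θ : Param 2} (h1 : 0 < θ 1) (h : θ 1 + 1 < θ 0) :
    HasSum (statDist θ) 1 := by
  have hc : 0 < θ 0 - θ 1 := by linarith
  have h := (hasSum_choose_mul_beta 0 h1 hc).div_const (beta (θ 1) (θ 0 - θ 1))
  rw [div_self (beta_pos h1 hc).ne'] at h
  refine (hasSum_of_eq fun y => ?_) h
  simp [statDist]

/-- As k + 1 = C(1+k,1), this is the binomial series with m = 1 and c = α - β - 1, which is positive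
exactly when α > β + 1. -/
theorem summable_statDist_mul {θ : Param 2} (h1 : 0 < θ 1) (h : θ 1 + 1 < θ 0) :
    Summable (fun k : ℕ => statDist θ k * (k + 1)) := by
  have hc : 0 < θ 0 - θ 1 - 1 := by linarith
  have h := ((hasSum_choose_mul_beta 1 h1 hc).div_const (beta (θ 1) (θ 0 - θ 1))).summable
  refine h.congr fun k => ?_
  rw [statDist, add_comm 1 k, Nat.choose_one_right]
  push_cast
  rw [show θ 0 - θ 1 - 1 + 1 + 1 = θ 0 - θ 1 + 1 by ring]
  ring

/-- The factor Γ(α+x+1) cancels between the two Beta functions, leaving an expression symmetric in x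
and y. -/
theorem statDist_detailed_balance {θ : Param 2} (h0 : 0 < θ 0) (h1 : 0 < θ 1)
    (x y : ℕ) :
    statDist θ x * Q betaEnv θ x y = statDist θ y * Q betaEnv θ y x := by
  have hG : ∀ n : ℕ, Real.Gamma (θ 0 + n + 1) ≠ 0 := fun n =>
    (Real.Gamma_pos_of_pos (by positivity)).ne'
  rw [Q_betaEnv h0 h1, Q_betaEnv h0 h1, statDist, statDist, add_comm y x, ← Nat.choose_symm_add]
  have key : ∀ n k : ℕ, beta (θ 1 + n) (θ 0 - θ 1 + 1) * beta (θ 0 + n + 1) (θ 1 + k) =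
      Real.Gamma (θ 1 + n) * Real.Gamma (θ 1 + k) * Real.Gamma (θ 0 - θ 1 + 1) /
        Real.Gamma (θ 0 + θ 1 + 1 + (n + k)) := by
    intro n k
    rw [beta, beta, show θ 1 + n + (θ 0 - θ 1 + 1) = θ 0 + n + 1 by ring,
      show θ 0 + n + 1 + (θ 1 + k) = θ 0 + θ 1 + 1 + (n + k) by ring]
    field_simp [hG n]
  have e : beta (θ 1 + x) (θ 0 - θ 1 + 1) * beta (θ 0 + x + 1) (θ 1 + y) =
      beta (θ 1 + y) (θ 0 - θ 1 + 1) * beta (θ 0 + y + 1) (θ 1 + x) := by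
    rw [key, key, add_comm (y : ℝ) x]
    ring
  linear_combination ((x + y).choose x : ℝ) / (beta (θ 0) (θ 1) * beta (θ 1) (θ 0 - θ 1)) * e

/-- The difference h of two stationary laws is invariant with total mass 0. Since |h| ≤ |h|K with
equal totals, equality holds everywhere; as K is positive, h then has constant sign and must vanish.
-/
theorem IsStationaryDist.eq_of_pos {K : ℕ → ℕ → ℝ} (hpos : ∀ x y, 0 < K x y)
    (hsum : ∀ x, HasSum (K x) 1) {p p' : ℕ → ℝ} (hp : IsStationaryDist K p)
    (hp' : IsStationaryDist K p') : p' = p := by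
  obtain ⟨h, hh⟩ : ∃ h : ℕ → ℝ, ∀ x, h x = p' x - p x := ⟨_, fun _ => rfl⟩
  have hs : HasSum h 0 := hasSum_of_eq hh (by simpa using hp'.hasSum_one.sub hp.hasSum_one)
  have hinv : ∀ y, HasSum (fun x => h x * K x y) (h y) := fun y => by
    simpa [hh, sub_mul] using (hp'.invariant y).sub (hp.invariant y)
  have habs : Summable fun x => |h x| := hs.summable.abs
  have hprod : Summable fun z : ℕ × ℕ => |h z.1| * K z.1 z.2 := by
    refine (summable_prod_of_nonneg
      (fun z : ℕ × ℕ => mul_nonneg (abs_nonneg (h z.1)) (hpos z.1 z.2).le)).2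
      ⟨fun x => (hsum x).summable.mul_left |h x|, ?_⟩
    refine habs.congr fun x => ?_
    rw [((hsum x).mul_left |h x|).tsum_eq, mul_one]
  have hcol : ∀ y, Summable fun x => |h x| * K x y := fun y =>
    hprod.prod_symm.prod_factor y
  have hle : ∀ y, |h y| ≤ ∑' x, |h x| * K x y := fun y => by
    rw [← (hinv y).tsum_eq]
    have := norm_tsum_le_tsum_norm (f := fun x => h x * K x y) (hinv y).summable.norm
    simpa [abs_mul, abs_of_pos (hpos _ y)] using this
  have htot : ∑' y, ∑' x, |h x| * K x y = ∑' x, |h x| := by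
    rw [hprod.tsum_comm (f := fun x y => |h x| * K x y)]
    refine tsum_congr fun x => ?_
    rw [((hsum x).mul_left |h x|).tsum_eq, mul_one]
  have hcols : Summable fun y => ∑' x, |h x| * K x y := hprod.prod_symm.prod
  have heq : ∀ y, |h y| = ∑' x, |h x| * K x y := by
    have hz : HasSum (fun y => (∑' x, |h x| * K x y) - |h y|) 0 := by
      simpa [htot] using hcols.hasSum.sub habs.hasSum
    have := (hasSum_zero_iff_of_nonneg (fun y => sub_nonneg.2 (hle y))).1 hz
    intro y
    have := congrFun this y
    simp only [Pi.zero_apply] at this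
    linarith
  -- Here s is a sign of h 0. Equality in column 0 makes a sum of nonnegative terms vanish, and K x
  -- 0 > 0 forces each |h x| = s * h x.
  have hzero : ∀ s : ℝ, |h 0| = s * h 0 → (∀ x, s * h x ≤ |h x|) → ∀ x, |h x| = s * h x := by
    intro s h00 hsle x
    have hz : HasSum (fun x => (|h x| - s * h x) * K x 0) 0 := by
      have := (hcol 0).hasSum.sub ((hinv 0).mul_left s)
      rw [← heq 0, h00, sub_self] at this
      refine (hasSum_of_eq fun x => ?_) this
      ring
    have h2 := congrFun ((hasSum_zero_iff_of_nonneg (fun x =>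
      mul_nonneg (sub_nonneg.2 (hsle x)) (hpos x 0).le)).1 hz) x
    have h3 := (mul_eq_zero.1 h2).resolve_right (hpos x 0).ne'
    linarith
  have hall : ∀ x, |h x| = 0 := by
    obtain ⟨s, hs'⟩ : ∃ s : ℝ, ∀ x, |h x| = s * h x := by
      rcases le_total 0 (h 0) with h0 | h0
      · exact ⟨1, hzero 1 (by rw [abs_of_nonneg h0, one_mul])
          (fun x => by rw [one_mul]; exact le_abs_self _)⟩
      · exact ⟨-1, hzero (-1) (by rw [abs_of_nonpos h0]; ring)
          (fun x => by rw [neg_one_mul]; exact neg_le_abs _)⟩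
    have h4 : HasSum (fun x => |h x|) 0 := by
      simpa [hs'] using hs.mul_left s
    exact fun x => congrFun ((hasSum_zero_iff_of_nonneg (fun x => abs_nonneg (h x))).1 h4) x
  funext x
  have := abs_eq_zero.1 (hall x)
  rw [hh] at this
  linarith

theorem isTheStationaryDist_statDist {θ : Param 2} (h0 : 0 < θ 0) (h1 : 0 < θ 1)
    (h : θ 1 + 1 < θ 0) : IsTheStationaryDist (Q betaEnv θ) (statDist θ) := by
  have hst : IsStationaryDist (Q betaEnv θ) (statDist θ) :=
    { nonneg := statDist_nonneg h1 h
      hasSum_one := hasSum_statDist h1 h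
      invariant := fun y => by
        simpa [statDist_detailed_balance h0 h1 _ y] using
          (hasSum_Q h0 h1 y).mul_left (statDist θ y) }
  exact ⟨hst, fun p' hp' => hst.eq_of_pos (Q_pos h0 h1) (hasSum_Q h0 h1) hp'⟩

/-! ### Integrability under the pair law -/

theorem pairSum_lt_top_of_le {p : ℕ → ℝ} {K : ℕ → ℕ → ℝ} (hp : ∀ x, 0 ≤ p x)
    (hK : ∀ x y, 0 ≤ K x y) (hsum : ∀ x, HasSum (K x) 1)
    (hbal : ∀ x y, p x * K x y = p y * K y x) (hmean : Summable fun k : ℕ => p k * (k + 1))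
    {g : ℕ → ℕ → ℝ≥0∞} {C : ℝ} (hC : 0 ≤ C)
    (hg : ∀ x y : ℕ, g x y ≤ ENNReal.ofReal (C * (1 + x + y))) : pairSum p K g < ∞ := by
  set T : ℝ≥0∞ := ∑' x : ℕ, ∑' y : ℕ, ENNReal.ofReal (p x * K x y) * ENNReal.ofReal (C * (x + 1))
    with hT
  have hTval : T = ∑' x : ℕ, ENNReal.ofReal (C * (p x * (x + 1))) := by
    refine tsum_congr fun x => ?_
    rw [ENNReal.tsum_mul_right, ← ENNReal.ofReal_tsum_of_nonneg
      (fun y => mul_nonneg (hp x) (hK x y)) ((hsum x).summable.mul_left _),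
      ((hsum x).mul_left (p x)).tsum_eq, mul_one, ← ENNReal.ofReal_mul (hp x)]
    congr 1
    ring
  have hTfin : T < ∞ := by
    rw [hTval, ← ENNReal.ofReal_tsum_of_nonneg
      (fun x => mul_nonneg hC (mul_nonneg (hp x) (by positivity))) (hmean.mul_left C)]
    exact ENNReal.ofReal_lt_top
  -- Detailed balance exchanges the coordinates, so the sum in y reduces to the one in x.
  have hsymm : ∑' x : ℕ, ∑' y : ℕ, ENNReal.ofReal (p x * K x y) * ENNReal.ofReal (C * (y + 1)) = T := by
    rw [ENNReal.tsum_comm, hT]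
    exact tsum_congr fun y => tsum_congr fun x => by rw [hbal]
  refine lt_of_le_of_lt ?_ (ENNReal.add_lt_top.2 ⟨hTfin, hTfin⟩)
  nth_rewrite 2 [← hsymm]
  rw [hT, ← ENNReal.tsum_add]
  refine ENNReal.tsum_le_tsum fun x => ?_
  rw [← ENNReal.tsum_add]
  refine ENNReal.tsum_le_tsum fun y => ?_
  rw [← mul_add, ← ENNReal.ofReal_add (by positivity) (by positivity)]
  gcongr
  refine (hg x y).trans (ENNReal.ofReal_le_ofReal ?_)
  nlinarith

/-! ### Log-Gamma: smoothness and growth along integer shifts -/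

noncomputable def logGamma (t : ℝ) : ℝ := Real.log (Real.Gamma t)

/-- The complex Gamma function is holomorphic, hence analytic, on the right half-plane; smoothness
passes to the real axis. -/
theorem contDiffAt_logGamma {t : ℝ} (ht : 0 < t) (n : WithTop ℕ∞) :
    ContDiffAt ℝ n logGamma t := by
  have hopen : IsOpen {z : ℂ | 0 < z.re} := isOpen_lt continuous_const Complex.continuous_re
  have hd : DifferentiableOn ℂ Complex.Gamma {z : ℂ | 0 < z.re} := fun z hz =>
    (Complex.differentiableAt_Gamma z fun m hm => by
      have h1 : 0 < z.re := hz
      rw [hm] at h1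
      simp only [Complex.neg_re, Complex.natCast_re, Left.neg_pos_iff] at h1
      exact absurd h1 (not_lt.2 (Nat.cast_nonneg m))).differentiableWithinAt
  have hc : ContDiffAt ℂ n Complex.Gamma (t : ℂ) :=
    (hd.analyticAt (hopen.mem_nhds (by simpa using ht))).contDiffAt
  have hr : ContDiffAt ℝ n Real.Gamma t := hc.real_of_complex
  exact hr.log (Real.Gamma_pos_of_pos ht).ne'

theorem contDiffOn_logGamma (n : WithTop ℕ∞) : ContDiffOn ℝ n logGamma (Set.Ioi 0) :=
  fun _ ht => (contDiffAt_logGamma ht n).contDiffWithinAt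

theorem contDiffOn_deriv_logGamma : ContDiffOn ℝ 2 (deriv logGamma) (Set.Ioi 0) :=
  ((contDiffOn_succ_iff_deriv_of_isOpen isOpen_Ioi).1 (contDiffOn_logGamma (2 + 1))).2.2

theorem contDiffOn_deriv_deriv_logGamma :
    ContDiffOn ℝ 1 (deriv (deriv logGamma)) (Set.Ioi 0) :=
  ((contDiffOn_succ_iff_deriv_of_isOpen isOpen_Ioi).1
    (show ContDiffOn ℝ (1 + 1) _ _ by
      rw [one_add_one_eq_two]; exact contDiffOn_deriv_logGamma)).2.2

theorem logGamma_add_one {t : ℝ} (ht : 0 < t) : logGamma (t + 1) = logGamma t + Real.log t := by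
  rw [logGamma, logGamma, Real.Gamma_add_one ht.ne',
    Real.log_mul ht.ne' (Real.Gamma_pos_of_pos ht).ne', add_comm]

theorem differentiableAt_of_contDiffOn {f : ℝ → ℝ} {n : WithTop ℕ∞} (hn : n ≠ 0)
    (hf : ContDiffOn ℝ n f (Set.Ioi 0)) {t : ℝ} (ht : 0 < t) : DifferentiableAt ℝ f t :=
  (hf.differentiableOn hn).differentiableAt (Ioi_mem_nhds ht)

theorem deriv_logGamma_add_one {t : ℝ} (ht : 0 < t) :
    deriv logGamma (t + 1) = deriv logGamma t + t⁻¹ := by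
  have hd : ∀ {s : ℝ}, 0 < s → DifferentiableAt ℝ logGamma s := fun hs =>
    differentiableAt_of_contDiffOn one_ne_zero (contDiffOn_logGamma 1) hs
  rw [← deriv_comp_add_const, ← Real.deriv_log,
    ← deriv_add (hd ht) (Real.differentiableAt_log ht.ne')]
  exact Filter.EventuallyEq.deriv_eq
    ((eventually_gt_nhds ht).mono fun s hs => logGamma_add_one hs)

theorem deriv_deriv_logGamma_add_one {t : ℝ} (ht : 0 < t) :
    deriv (deriv logGamma) (t + 1) = deriv (deriv logGamma) t + -(t ^ 2)⁻¹ := by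
  have hd : ∀ {s : ℝ}, 0 < s → DifferentiableAt ℝ (deriv logGamma) s := fun hs =>
    differentiableAt_of_contDiffOn two_ne_zero contDiffOn_deriv_logGamma hs
  rw [← deriv_comp_add_const, ← deriv_inv, ← deriv_add (hd ht) (differentiableAt_inv ht.ne')]
  exact Filter.EventuallyEq.deriv_eq
    ((eventually_gt_nhds ht).mono fun s hs => deriv_logGamma_add_one hs)

/-- The growth condition satisfied, by compactness and the functional equation, by the digamma
function and its derivative. -/
def SlowGrowth (f : ℝ → ℝ) : Prop :=
  ∀ m M : ℝ, 0 < m → ∃ K : ℝ, 0 ≤ K ∧ ∀ t ∈ Set.Icc m M, ∀ n : ℕ,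
    |f (t + n)| ≤ K * (1 + n : ℝ) ^ (1 / 4 : ℝ)

theorem SlowGrowth.of_add_one {f g : ℝ → ℝ} (hf : ContinuousOn f (Set.Ioi 0))
    (hfg : ∀ t, 0 < t → f (t + 1) = f t + g t)
    (hg : ∀ m : ℝ, 0 < m → ∃ C : ℝ, 0 ≤ C ∧ ∀ t, m ≤ t → |g t| ≤ C / t) : SlowGrowth f := by
  intro m M hm
  obtain ⟨C, hC0, hC⟩ := hg m hm
  obtain ⟨B, hB⟩ := isCompact_Icc.exists_bound_of_continuousOn (s := Set.Icc m M)
    (hf.mono fun t ht => hm.trans_le ht.1)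
  -- Chosen so that C / (t + k) ≤ c / (k + 1), because t + k ≥ min m 1 * (k + 1).
  set c : ℝ := C / min m 1 with hc
  have hmin : 0 < min m 1 := lt_min hm one_pos
  have hc0 : 0 ≤ c := div_nonneg hC0 hmin.le
  refine ⟨|B| + 5 * c, by positivity, fun t ht n => ?_⟩
  have hstep : ∀ n : ℕ, |f (t + n)| ≤ |B| + c * (harmonic n : ℝ) := by
    intro n
    induction n with
    | zero => simpa using (hB t ht).trans (le_abs_self B)
    | succ k ih =>
      have hpos : 0 < t + k := by linarith [ht.1, (Nat.cast_nonneg k : (0 : ℝ) ≤ k)]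
      rw [Nat.cast_succ, ← add_assoc, hfg _ hpos, harmonic_succ]
      have h1 : |g (t + k)| ≤ C / (t + k) :=
        hC _ (by linarith [ht.1, (Nat.cast_nonneg k : (0 : ℝ) ≤ k)])
      have h2 : C / (t + k) ≤ c * ((k : ℝ) + 1)⁻¹ := by
        rw [hc, ← div_eq_mul_inv, div_div]
        refine div_le_div_of_nonneg_left hC0 (by positivity) ?_
        have h3 : min m 1 ≤ t := (min_le_left _ _).trans ht.1
        have h4 : min m 1 * k ≤ 1 * k :=
          mul_le_mul_of_nonneg_right (min_le_right _ _) (Nat.cast_nonneg k)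
        linarith
      push_cast
      calc |f (t + k) + g (t + k)| ≤ |f (t + k)| + |g (t + k)| := abs_add_le _ _
        _ ≤ _ := by rw [mul_add]; linarith
  -- The 5 is 1 + 4: the harmonic number is at most 1 + log n, and log n ≤ 4 n^(1/4).
  have hlog : (harmonic n : ℝ) ≤ 5 * (1 + n : ℝ) ^ (1 / 4 : ℝ) := by
    have h1 := harmonic_le_one_add_log n
    have h0 : (0 : ℝ) ≤ n := Nat.cast_nonneg n
    have h2 : Real.log n ≤ (n : ℝ) ^ (1 / 4 : ℝ) / (1 / 4) :=
      Real.log_le_rpow_div h0 (by norm_num)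
    have h3 : (n : ℝ) ^ (1 / 4 : ℝ) ≤ (1 + n : ℝ) ^ (1 / 4 : ℝ) :=
      Real.rpow_le_rpow h0 (by linarith) (by norm_num)
    have h4 : 1 ≤ (1 + n : ℝ) ^ (1 / 4 : ℝ) := Real.one_le_rpow (by linarith) (by norm_num)
    linarith
  have h4 : 1 ≤ (1 + n : ℝ) ^ (1 / 4 : ℝ) :=
    Real.one_le_rpow (by linarith [(Nat.cast_nonneg n : (0 : ℝ) ≤ n)]) (by norm_num)
  calc |f (t + n)| ≤ |B| * 1 + c * (harmonic n : ℝ) := by rw [mul_one]; exact hstep n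
    _ ≤ |B| * (1 + n : ℝ) ^ (1 / 4 : ℝ) + c * (5 * (1 + n : ℝ) ^ (1 / 4 : ℝ)) := by gcongr
    _ = _ := by ring

theorem slowGrowth_deriv_logGamma : SlowGrowth (deriv logGamma) :=
  .of_add_one contDiffOn_deriv_logGamma.continuousOn (fun _ => deriv_logGamma_add_one)
    fun m hm => ⟨1, zero_le_one, fun t ht => by
      rw [abs_of_pos (inv_pos.2 (hm.trans_le ht)), one_div]⟩

theorem slowGrowth_deriv_deriv_logGamma : SlowGrowth (deriv (deriv logGamma)) :=
  .of_add_one contDiffOn_deriv_deriv_logGamma.continuousOn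
    (fun _ => deriv_deriv_logGamma_add_one)
    fun m hm => ⟨m⁻¹, by positivity, fun t ht => by
      have ht0 : 0 < t := hm.trans_le ht
      rw [abs_neg, abs_of_pos (by positivity), pow_two, mul_inv, div_eq_mul_inv]
      gcongr⟩

/-! ### The derivatives of φ as combinations of shifts -/

/-- The combinations of shifts of `f` of which `φ` and its derivatives consist. -/
noncomputable def shiftComb (f : ℝ → ℝ) (c : Fin 3 → ℝ) (x y : ℕ) (θ : Param 2) : ℝ :=
  c 0 * (f (θ 0 + 1 + x) - f (θ 0)) + c 1 * (f (θ 1 + y) - f (θ 1)) -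
    c 2 * (f (θ 0 + θ 1 + 1 + (x + y : ℕ)) - f (θ 0 + θ 1))

/-- The factors that differentiation in direction `i` applies to the three terms of
`shiftComb`. -/
def dirCoeff (i : Fin 2) : Fin 3 → ℝ := ![![1, 0, 1], ![0, 1, 1]] i

theorem abs_dirCoeff_le (i : Fin 2) (k : Fin 3) : |dirCoeff i k| ≤ 1 := by
  fin_cases i <;> fin_cases k <;> simp [dirCoeff]

def posParam : Set (Param 2) := {θ | 0 < θ 0 ∧ 0 < θ 1}

theorem isOpen_posParam : IsOpen posParam :=
  (isOpen_lt continuous_const (continuous_apply 0)).inter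
    (isOpen_lt continuous_const (continuous_apply 1))

theorem phi_betaEnv {θ : Param 2} (h : θ ∈ posParam) (x y : ℕ) :
    phi betaEnv θ x y = shiftComb logGamma 1 x y θ := by
  obtain ⟨h0, h1⟩ := h
  have hG : ∀ {s : ℝ}, 0 < s → Real.Gamma s ≠ 0 := fun hs => (Real.Gamma_pos_of_pos hs).ne'
  have e : ∀ {u v : ℝ}, 0 < u → 0 < v → Real.log (ProbabilityTheory.beta u v) =
      logGamma u + logGamma v - logGamma (u + v) := fun hu hv => by
    rw [ProbabilityTheory.beta, Real.log_div (mul_ne_zero (hG hu) (hG hv)) (hG (add_pos hu hv)),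
      Real.log_mul (hG hu) (hG hv)]
    rfl
  have hx : 0 < θ 0 + x + 1 := by positivity
  have hy : 0 < θ 1 + y := by positivity
  rw [phi, envMoment_betaEnv h0 h1, Real.log_div (ProbabilityTheory.beta_pos hx hy).ne'
    (ProbabilityTheory.beta_pos h0 h1).ne', e hx hy, e h0 h1, shiftComb]
  rw [show θ 0 + x + 1 + (θ 1 + y) = θ 0 + θ 1 + 1 + (x + y : ℕ) by push_cast; ring,
    show θ 0 + x + 1 = θ 0 + 1 + x by ring]
  simp only [Pi.one_apply]
  ring

theorem contDiffAt_shiftComb {f : ℝ → ℝ} {n : WithTop ℕ∞} (hf : ContDiffOn ℝ n f (Set.Ioi 0))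
    (c : Fin 3 → ℝ) (x y : ℕ) {θ : Param 2} (h : θ ∈ posParam) :
    ContDiffAt ℝ n (shiftComb f c x y) θ := by
  obtain ⟨h0, h1⟩ := h
  have hs : ∀ {s : ℝ}, 0 < s → ContDiffAt ℝ n f s := fun hs => hf.contDiffAt (Ioi_mem_nhds hs)
  have hc : ∀ {l : Param 2 → ℝ}, ContDiff ℝ n l → 0 < l θ → ContDiffAt ℝ n (fun η => f (l η)) θ :=
    fun {l} hl hp => (hs hp).comp θ hl.contDiffAt
  unfold shiftComb
  refine ContDiffAt.sub (ContDiffAt.add (contDiffAt_const.mul (ContDiffAt.sub ?_ ?_))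
    (contDiffAt_const.mul (ContDiffAt.sub ?_ ?_))) (contDiffAt_const.mul (ContDiffAt.sub ?_ ?_)) <;>
  exact hc (by fun_prop) (by positivity)

/-- Both arguments in a bracket have the same linear part (α, β or α+β), so a partial derivative
replaces f by f' and rescales the bracket. The family is closed under differentiation. -/
theorem grad_shiftComb {f : ℝ → ℝ} (hf : ∀ t, 0 < t → DifferentiableAt ℝ f t)
    (c : Fin 3 → ℝ) (x y : ℕ) {θ : Param 2} (h : θ ∈ posParam) (i : Fin 2) :
    grad (shiftComb f c x y) θ i = shiftComb (deriv f) (c * dirCoeff i) x y θ := by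
  obtain ⟨h0, h1⟩ := h
  have e0 : HasFDerivAt (fun η : Param 2 => η 0) (ContinuousLinearMap.proj 0) θ :=
    (ContinuousLinearMap.proj (R := ℝ) (φ := fun _ : Fin 2 => ℝ) 0).hasFDerivAt
  have e1 : HasFDerivAt (fun η : Param 2 => η 1) (ContinuousLinearMap.proj 1) θ :=
    (ContinuousLinearMap.proj (R := ℝ) (φ := fun _ : Fin 2 => ℝ) 1).hasFDerivAt
  have hc : ∀ {l : Param 2 → ℝ} {l' : Param 2 →L[ℝ] ℝ}, HasFDerivAt l l' θ → 0 < l θ →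
      HasFDerivAt (fun η => f (l η)) (deriv f (l θ) • l') θ :=
    fun hl hp => (hf _ hp).hasDerivAt.comp_hasFDerivAt θ hl
  have H := ((((hc ((e0.add_const 1).add_const (x : ℝ)) (by positivity)).sub
    (hc e0 h0)).const_mul (c 0)).add
    (((hc (e1.add_const (y : ℝ)) (by positivity)).sub (hc e1 h1)).const_mul (c 1))).sub
    (((hc (((e0.add e1).add_const 1).add_const ((x + y : ℕ) : ℝ)) (by
      simp only [Pi.add_apply]; positivity)).sub
    (hc (e0.add e1) (add_pos h0 h1))).const_mul (c 2))
  have H' : HasFDerivAt (shiftComb f c x y) _ θ := H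
  rw [grad, H'.fderiv]
  fin_cases i <;> simp [dirCoeff, shiftComb]

theorem grad_congr {d : ℕ} {f g : Param d → ℝ} {θ : Param d} (h : f =ᶠ[𝓝 θ] g) :
    grad f θ = grad g θ := by
  unfold grad
  rw [h.fderiv_eq]

theorem grad_phi {θ : Param 2} (h : θ ∈ posParam) (x y : ℕ) (i : Fin 2) :
    grad (fun η => phi betaEnv η x y) θ i = shiftComb (deriv logGamma) (dirCoeff i) x y θ := by
  rw [grad_congr ((isOpen_posParam.eventually_mem h).mono
    fun η hη => phi_betaEnv hη x y), grad_shiftComb (fun t ht => differentiableAt_of_contDiffOn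
      one_ne_zero (contDiffOn_logGamma 1) ht) _ _ _ h, one_mul]

theorem hess_phi {θ : Param 2} (h : θ ∈ posParam) (x y : ℕ) (i j : Fin 2) :
    hess (fun η => phi betaEnv η x y) θ i j =
      shiftComb (deriv (deriv logGamma)) (dirCoeff j * dirCoeff i) x y θ := by
  rw [hess, grad_congr ((isOpen_posParam.eventually_mem h).mono
    fun η hη => grad_phi hη x y j), grad_shiftComb (fun t ht => differentiableAt_of_contDiffOn
      two_ne_zero contDiffOn_deriv_logGamma ht) _ _ _ h]

theorem contDiffAt_phi {θ : Param 2} (h : θ ∈ posParam) (x y : ℕ) :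
    ContDiffAt ℝ 2 (fun η => phi betaEnv η x y) θ :=
  (contDiffAt_shiftComb (contDiffOn_logGamma 2) 1 x y h).congr_of_eventuallyEq
    ((isOpen_posParam.eventually_mem h).mono
      fun _ hη => phi_betaEnv hη x y)

theorem SlowGrowth.exists_shiftComb_bound {f : ℝ → ℝ} (hf : SlowGrowth f) {lo hi : Param 2}
    (hlo : lo ∈ posParam) : ∃ D : ℝ, 0 ≤ D ∧ ∀ θ ∈ Set.Icc lo hi, ∀ c : Fin 3 → ℝ,
      (∀ k, |c k| ≤ 1) → ∀ x y : ℕ,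
      |shiftComb f c x y θ| ≤ D * (1 + x + y : ℝ) ^ (1 / 4 : ℝ) := by
  -- This interval contains all base points α, α+1, β, α+β, α+β+1. Three brackets of two values each
  -- give 6 * K.
  obtain ⟨K, hK0, hK⟩ := hf (min (lo 0) (lo 1)) (hi 0 + hi 1 + 1) (lt_min hlo.1 hlo.2)
  refine ⟨6 * K, by positivity, fun θ hθ c hc x y => ?_⟩
  set R : ℝ := (1 + x + y : ℝ) ^ (1 / 4 : ℝ) with hR
  have l0 : lo 0 ≤ θ 0 := hθ.1 0
  have l1 : lo 1 ≤ θ 1 := hθ.1 1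
  have u0 : θ 0 ≤ hi 0 := hθ.2 0
  have u1 : θ 1 ≤ hi 1 := hθ.2 1
  have p0 := hlo.1
  have p1 := hlo.2
  have m0 := min_le_left (lo 0) (lo 1)
  have m1 := min_le_right (lo 0) (lo 1)
  have key : ∀ t ∈ Set.Icc (min (lo 0) (lo 1)) (hi 0 + hi 1 + 1), ∀ n : ℕ, n ≤ x + y →
      |f (t + n)| ≤ K * R := fun t ht n hn => by
    refine (hK t ht n).trans ?_
    have : (n : ℝ) ≤ x + y := by exact_mod_cast hn
    rw [hR, add_assoc]
    gcongr
  have key0 : ∀ t ∈ Set.Icc (min (lo 0) (lo 1)) (hi 0 + hi 1 + 1), |f t| ≤ K * R :=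
    fun t ht => by simpa using key t ht 0 (Nat.zero_le _)
  have hd : ∀ (a b : ℝ) (k : Fin 3), |a| ≤ K * R → |b| ≤ K * R →
      |c k * (a - b)| ≤ 2 * (K * R) := fun a b k ha hb => by
    rw [abs_mul]
    calc |c k| * |a - b| ≤ 1 * (|a| + |b|) := mul_le_mul (hc k) (abs_sub a b) (abs_nonneg _) one_pos.le
      _ ≤ _ := by linarith
  have A := hd _ _ 0 (key (θ 0 + 1) ⟨by linarith, by linarith⟩ x (Nat.le_add_right _ _))
    (key0 (θ 0) ⟨by linarith, by linarith⟩)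
  have B := hd _ _ 1 (key (θ 1) ⟨by linarith, by linarith⟩ y (Nat.le_add_left _ _))
    (key0 (θ 1) ⟨by linarith, by linarith⟩)
  have C := hd _ _ 2 (key (θ 0 + θ 1 + 1) ⟨by linarith, by linarith⟩ (x + y) le_rfl)
    (key0 (θ 0 + θ 1) ⟨by linarith, by linarith⟩)
  unfold shiftComb
  refine (abs_sub _ _).trans ?_
  have := abs_add_le (c 0 * (f (θ 0 + 1 + x) - f (θ 0))) (c 1 * (f (θ 1 + y) - f (θ 1)))
  linarith

theorem exists_grad_hess_phi_bound {lo hi : Param 2} (hlo : lo ∈ posParam) :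
    ∃ D : ℝ, 0 ≤ D ∧ ∀ θ ∈ Set.Icc lo hi, ∀ x y : ℕ,
      ‖grad (fun η => phi betaEnv η x y) θ‖ ≤ D * (1 + x + y : ℝ) ^ (1 / 4 : ℝ) ∧
      ‖hess (fun η => phi betaEnv η x y) θ‖ ≤ D * (1 + x + y : ℝ) ^ (1 / 4 : ℝ) := by
  obtain ⟨D₁, h₁, H₁⟩ := slowGrowth_deriv_logGamma.exists_shiftComb_bound (hi := hi) hlo
  obtain ⟨D₂, h₂, H₂⟩ := slowGrowth_deriv_deriv_logGamma.exists_shiftComb_bound (hi := hi) hlo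
  refine ⟨max D₁ D₂, le_max_of_le_left h₁, fun θ hθ x y => ?_⟩
  have hpos : θ ∈ posParam := ⟨hlo.1.trans_le (hθ.1 0), hlo.2.trans_le (hθ.1 1)⟩
  have hR : 0 ≤ (1 + x + y : ℝ) ^ (1 / 4 : ℝ) := by positivity
  have hD : 0 ≤ max D₁ D₂ * (1 + x + y : ℝ) ^ (1 / 4 : ℝ) :=
    mul_nonneg (le_max_of_le_left h₁) hR
  constructor
  · refine (pi_norm_le_iff_of_nonneg hD).2 fun i => ?_
    rw [grad_phi hpos, Real.norm_eq_abs]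
    exact (H₁ θ hθ _ (abs_dirCoeff_le i) x y).trans
      (mul_le_mul_of_nonneg_right (le_max_left _ _) hR)
  · refine (pi_norm_le_iff_of_nonneg hD).2 fun i => (pi_norm_le_iff_of_nonneg hD).2 fun j => ?_
    rw [hess_phi hpos, Real.norm_eq_abs]
    refine (H₂ θ hθ _ (fun k => ?_) x y).trans
      (mul_le_mul_of_nonneg_right (le_max_right _ _) hR)
    rw [Pi.mul_apply, abs_mul]
    exact mul_le_one₀ (abs_dirCoeff_le j k) (abs_nonneg _) (abs_dirCoeff_le i k)

/-! ### Domination of the kernel and its gradient on boxes -/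

theorem exists_box {θ : Param 2} (h0 : 1 < θ 0) (h1 : 0 < θ 1) :
    ∃ lo hi : Param 2, lo ∈ posParam ∧ 1 < lo 0 ∧ ∃ V : Set (Param 2), IsOpen V ∧ Convex ℝ V ∧
      θ ∈ V ∧ V ⊆ Set.Icc lo hi := by
  -- The midpoint of 1 and α keeps the first coordinate above 1 throughout the box.
  refine ⟨![(1 + θ 0) / 2, θ 1 / 2], ![θ 0 + 1, θ 1 + 1], ⟨?_, ?_⟩, ?_,
    Set.pi Set.univ fun i => Set.Ioo (![(1 + θ 0) / 2, θ 1 / 2] i) (![θ 0 + 1, θ 1 + 1] i),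
    isOpen_set_pi Set.finite_univ fun _ _ => isOpen_Ioo, convex_pi fun _ _ => convex_Ioo _ _,
    fun i _ => ?_, fun η hη => ⟨fun i => (hη i trivial).1.le, fun i => (hη i trivial).2.le⟩⟩
  · simp; linarith
  · simpa using h1
  · simp; linarith
  · fin_cases i <;> simp <;> linarith

theorem mem_posParam_of_mem_Icc {lo hi θ : Param 2} (hlo : lo ∈ posParam)
    (h : θ ∈ Set.Icc lo hi) : θ ∈ posParam :=
  ⟨hlo.1.trans_le (h.1 0), hlo.2.trans_le (h.1 1)⟩

/-- The Beta function decreases in each argument: the numerator is largest at `lo`, the denominator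
smallest at `hi`. -/
theorem Q_le_of_mem_Icc {lo hi θ : Param 2} (hlo : lo ∈ posParam) (h : θ ∈ Set.Icc lo hi)
    (x y : ℕ) : Q betaEnv θ x y ≤
      ((x + y).choose x : ℝ) * (beta (lo 0 + x + 1) (lo 1 + y) / beta (hi 0) (hi 1)) := by
  obtain ⟨h0, h1⟩ := mem_posParam_of_mem_Icc hlo h
  obtain ⟨l0, l1⟩ := hlo
  rw [Q_betaEnv h0 h1]
  have b1 := h.1 0
  have b2 := h.1 1
  have p1 : 0 < beta (lo 0 + x + 1) (lo 1 + y) := beta_pos (by positivity) (by positivity)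
  have p2 : 0 < beta (hi 0) (hi 1) := beta_pos (h0.trans_le (h.2 0)) (h1.trans_le (h.2 1))
  have e1 : beta (θ 0 + x + 1) (θ 1 + y) ≤ beta (lo 0 + x + 1) (lo 1 + y) :=
    beta_le_beta (by positivity) (by positivity) (by linarith) (by linarith)
  have e2 : beta (hi 0) (hi 1) ≤ beta (θ 0) (θ 1) := beta_le_beta h0 h1 (h.2 0) (h.2 1)
  gcongr

/-- The identity (x+y+1) C(x+y,x) = (x+1) C(x+1+y,x+1) absorbs the linear factor, at the cost of
lowering a to a - 1 > 0 in the binomial series. -/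
theorem summable_mul_choose_mul_beta (x : ℕ) {a b : ℝ} (ha : 1 < a) (hb : 0 < b) :
    Summable fun y : ℕ => (1 + x + y : ℝ) * (((x + y).choose x : ℝ) * beta (a + x + 1) (b + y)) := by
  have h := ((hasSum_choose_mul_beta (x + 1) hb (sub_pos.2 ha)).mul_left (x + 1 : ℝ)).summable
  refine h.congr fun y => ?_
  have e := Nat.add_one_mul_choose_eq (x + y) x
  have e' : ((x : ℝ) + y + 1) * ((x + y).choose x : ℝ) =
      ((x + 1 + y).choose (x + 1) : ℝ) * (x + 1) := by
    rw [add_right_comm x 1 y]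
    exact_mod_cast e
  rw [beta_comm (a + x + 1), show a - 1 + ((x + 1 : ℕ) : ℝ) + 1 = a + x + 1 by push_cast; ring]
  linear_combination -(beta (b + y) (a + x + 1)) * e'

theorem norm_fderiv_le_grad (f : Param 2 → ℝ) (θ : Param 2) :
    ‖fderiv ℝ f θ‖ ≤ 2 * ‖grad f θ‖ := by
  refine ContinuousLinearMap.opNorm_le_bound _ (by positivity) fun v => ?_
  have hv : v = v 0 • Pi.single (0 : Fin 2) (1 : ℝ) + v 1 • Pi.single (1 : Fin 2) (1 : ℝ) := by
    ext i
    fin_cases i <;> simp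
  have e : fderiv ℝ f θ v = v 0 * grad f θ 0 + v 1 * grad f θ 1 := by
    conv_lhs => rw [hv]
    rw [map_add, map_smul, map_smul]
    rfl
  rw [e]
  have n0 := norm_le_pi_norm v 0
  have n1 := norm_le_pi_norm v 1
  have g0 := norm_le_pi_norm (grad f θ) 0
  have g1 := norm_le_pi_norm (grad f θ) 1
  calc ‖v 0 * grad f θ 0 + v 1 * grad f θ 1‖ ≤ ‖v 0‖ * ‖grad f θ 0‖ + ‖v 1‖ * ‖grad f θ 1‖ := by
        simpa only [norm_mul] using norm_add_le (v 0 * grad f θ 0) (v 1 * grad f θ 1)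
    _ ≤ ‖v‖ * ‖grad f θ‖ + ‖v‖ * ‖grad f θ‖ := by gcongr
    _ = _ := by ring

theorem hasFDerivAt_Q {θ : Param 2} (h : θ ∈ posParam) (x y : ℕ) :
    HasFDerivAt (fun η => Q betaEnv η x y)
      (Q betaEnv θ x y • fderiv ℝ (fun η => phi betaEnv η x y) θ) θ := by
  have e : ∀ η ∈ posParam, Q betaEnv η x y =
      ((x + y).choose x : ℝ) * Real.exp (phi betaEnv η x y) := fun η hη => by
    rw [Q, phi, Real.exp_log (envMoment_pos hη.1 hη.2 x y)]
  have hd := ((contDiffAt_phi h x y).differentiableAt two_ne_zero).hasFDerivAt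
  have H := hd.exp.const_mul ((x + y).choose x : ℝ)
  rw [smul_smul, ← e θ h] at H
  exact H.congr_of_eventuallyEq ((isOpen_posParam.eventually_mem h).mono e)

/-! ### Moment bounds and termwise differentiation -/

theorem rpow_quarter_pow_four {r : ℝ} (hr : 0 ≤ r) : (r ^ (1 / 4 : ℝ)) ^ 4 = r := by
  rw [← Real.rpow_natCast, ← Real.rpow_mul hr]
  norm_num

theorem rpow_quarter_pow_le {r : ℝ} (hr : 1 ≤ r) {k : ℕ} (hk : k ≤ 4) :
    (r ^ (1 / 4 : ℝ)) ^ k ≤ r :=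
  (pow_le_pow_right₀ (Real.one_le_rpow hr (by norm_num)) hk).trans_eq
    (rpow_quarter_pow_four (zero_le_one.trans hr))

theorem enorm_pow_le {E : Type*} [SeminormedAddCommGroup E] {g : E} {D r : ℝ} (hr : 1 ≤ r)
    (hg : ‖g‖ ≤ D * r ^ (1 / 4 : ℝ)) {k : ℕ} (hk : k ≤ 4) :
    ‖g‖ₑ ^ k ≤ ENNReal.ofReal (|D| ^ k * r) := by
  rw [← ofReal_norm, ← ENNReal.ofReal_pow (norm_nonneg _)]
  refine ENNReal.ofReal_le_ofReal ?_
  have hq : 0 ≤ r ^ (1 / 4 : ℝ) := Real.rpow_nonneg (zero_le_one.trans hr) _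
  calc ‖g‖ ^ k ≤ (|D| * r ^ (1 / 4 : ℝ)) ^ k := by
        gcongr
        exact hg.trans (mul_le_mul_of_nonneg_right (le_abs_self D) hq)
    _ = |D| ^ k * (r ^ (1 / 4 : ℝ)) ^ k := mul_pow _ _ _
    _ ≤ _ := by
        gcongr
        exact rpow_quarter_pow_le hr hk

theorem one_le_one_add_natCast_add (x y : ℕ) : (1 : ℝ) ≤ 1 + x + y := by
  linarith [(Nat.cast_nonneg x : (0 : ℝ) ≤ x), (Nat.cast_nonneg y : (0 : ℝ) ≤ y)]

theorem pairSum_statDist_lt_top {θ : Param 2} (h0 : 0 < θ 0) (h1 : 0 < θ 1) (h : θ 1 + 1 < θ 0)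
    {g : ℕ → ℕ → ℝ≥0∞} {C : ℝ} (hC : 0 ≤ C)
    (hg : ∀ x y : ℕ, g x y ≤ ENNReal.ofReal (C * (1 + x + y))) :
    pairSum (statDist θ) (Q betaEnv θ) g < ∞ :=
  pairSum_lt_top_of_le (statDist_nonneg h1 h) (fun x y => (Q_pos h0 h1 x y).le) (hasSum_Q h0 h1)
    (statDist_detailed_balance h0 h1) (summable_statDist_mul h1 h) hC hg

theorem pairSum_grad_phi_lt_top {θ : Param 2} (h0 : 0 < θ 0) (h1 : 0 < θ 1)
    (h : θ 1 + 1 < θ 0) :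
    pairSum (statDist θ) (Q betaEnv θ)
      (fun x y => ‖grad (fun θ' => phi betaEnv θ' x y) θ‖ₑ ^ (2 * (2 : ℝ))) < ∞ := by
  obtain ⟨D, -, hD⟩ := exists_grad_hess_phi_bound (lo := θ) (hi := θ) ⟨h0, h1⟩
  refine pairSum_statDist_lt_top h0 h1 h (C := |D| ^ 4) (by positivity) fun x y => ?_
  rw [show (2 * 2 : ℝ) = ((4 : ℕ) : ℝ) by norm_num, ENNReal.rpow_natCast]
  exact enorm_pow_le (one_le_one_add_natCast_add x y) (hD θ ⟨le_rfl, le_rfl⟩ x y).1 le_rfl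

/-- The derivative of Q is Q times that of φ, so on a box it is dominated by a summable multiple of
(1+x+y) times the bound on Q. The summed derivative is that of the constant 1. -/
theorem hasSum_fderiv_Q {θ : Param 2} (h0 : 1 < θ 0) (h1 : 0 < θ 1) (x : ℕ) :
    HasSum (fun y : ℕ => fderiv ℝ (fun η => Q betaEnv η x y) θ) 0 := by
  obtain ⟨lo, hi, hlo, hlo1, V, hVo, hVc, hθ, hV⟩ := exists_box h0 h1
  obtain ⟨D, hD0, hD⟩ := exists_grad_hess_phi_bound (hi := hi) hlo
  have hpos : ∀ η ∈ V, η ∈ posParam := fun η hη => mem_posParam_of_mem_Icc hlo (hV hη)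
  set u : ℕ → ℝ := fun y => 2 * D / beta (hi 0) (hi 1) *
    ((1 + x + y : ℝ) * (((x + y).choose x : ℝ) * beta (lo 0 + x + 1) (lo 1 + y))) with hu
  have hus : Summable u := (summable_mul_choose_mul_beta x hlo1 hlo.2).mul_left _
  have hbound : ∀ y : ℕ, ∀ η ∈ V, ‖fderiv ℝ (fun η => Q betaEnv η x y) η‖ ≤ u y := by
    intro y η hη
    obtain ⟨p0, p1⟩ := hpos η hη
    have hQ := (Q_pos p0 p1 x y).le
    rw [(hasFDerivAt_Q (hpos η hη) x y).fderiv, norm_smul, Real.norm_of_nonneg hQ]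
    have hr := one_le_one_add_natCast_add x y
    have e1 : (1 + x + y : ℝ) ^ (1 / 4 : ℝ) ≤ 1 + x + y := by
      simpa using rpow_quarter_pow_le hr (k := 1) (by norm_num)
    have e2 : ‖fderiv ℝ (fun η => phi betaEnv η x y) η‖ ≤ 2 * (D * (1 + x + y)) :=
      (norm_fderiv_le_grad _ _).trans (by gcongr; exact (hD η (hV hη) x y).1.trans (by gcongr))
    calc _ ≤ _ := mul_le_mul (Q_le_of_mem_Icc hlo (hV hη) x y) e2 (norm_nonneg _)
            (hQ.trans (Q_le_of_mem_Icc hlo (hV hη) x y))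
      _ = u y := by rw [hu]; ring
  have hder : ∀ y : ℕ, ∀ η ∈ V, HasFDerivAt (fun η => Q betaEnv η x y)
      (fderiv ℝ (fun η => Q betaEnv η x y) η) η := fun y η hη =>
    (hasFDerivAt_Q (hpos η hη) x y).differentiableAt.hasFDerivAt
  have hsum := hasFDerivAt_tsum_of_isPreconnected hus hVo hVc.isPreconnected hder hbound hθ
    (hasSum_Q (hpos θ hθ).1 (hpos θ hθ).2 x).summable hθ
  have hconst : HasFDerivAt (fun η => ∑' y, Q betaEnv η x y) (0 : Param 2 →L[ℝ] ℝ) θ :=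
    (hasFDerivAt_const (1 : ℝ) θ).congr_of_eventuallyEq ((hVo.eventually_mem hθ).mono
      fun η hη => (hasSum_Q (hpos η hη).1 (hpos η hη).2 x).tsum_eq)
  rw [← hsum.unique hconst]
  exact (hus.of_norm_bounded fun y => hbound y θ hθ).hasSum

/-! ### Verification of the conditions -/

theorem regularity_betaEnv {Θ : Set (Param 2)}
    (hsub : Θ ⊆ {θ | 0 < θ 0 ∧ 0 < θ 1 ∧ θ 1 + 1 < θ 0}) :
    Regularity betaEnv statDist Θ := by
  refine ⟨fun θ hθ => ?_, fun θ hθ x => ?_⟩ <;> obtain ⟨h0, h1, h⟩ := hsub hθ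
  · exact ⟨2, one_lt_two, pairSum_grad_phi_lt_top h0 h1 h⟩
  · have hpos : ∀ᶠ η in 𝓝 θ, η ∈ posParam := isOpen_posParam.eventually_mem ⟨h0, h1⟩
    refine ⟨fun y => (hasFDerivAt_Q ⟨h0, h1⟩ x y).differentiableAt, ?_,
      hpos.mono fun η hη => (hasSum_Q hη.1 hη.2 x).summable,
      (hasFDerivAt_const (1 : ℝ) θ).congr_of_eventuallyEq
        (hpos.mono fun η hη => (hasSum_Q hη.1 hη.2 x).tsum_eq)⟩
    refine Pi.hasSum.2 fun i => ?_
    simpa [grad] using (hasSum_fderiv_Q (by linarith) h1 x).mapL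
      (ContinuousLinearMap.apply ℝ ℝ (Pi.single i 1 : Param 2))

theorem uniformity_betaEnv {Θ : Set (Param 2)}
    (hsub : Θ ⊆ {θ | 0 < θ 0 ∧ 0 < θ 1 ∧ θ 1 + 1 < θ 0}) :
    Uniformity betaEnv statDist Θ := by
  intro θ hθ
  obtain ⟨h0, h1, h⟩ := hsub hθ
  obtain ⟨lo, hi, hlo, -, V, hVo, -, hθV, hV⟩ := exists_box (by linarith) h1
  obtain ⟨D, -, hD⟩ := exists_grad_hess_phi_bound (hi := hi) hlo
  refine ⟨V, hVo.mem_nhds hθV,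
    fun η hη x y => contDiffAt_phi (mem_posParam_of_mem_Icc hlo (hV hη)) x y, ?_, ?_⟩
  · refine pairSum_statDist_lt_top h0 h1 h (C := |D| ^ 2) (by positivity) fun x y =>
      iSup₂_le fun η hη => ?_
    exact enorm_pow_le (one_le_one_add_natCast_add x y) (hD η (hV hη) x y).1 (by norm_num)
  · refine pairSum_statDist_lt_top h0 h1 h (C := |D| ^ 1) (by positivity) fun x y =>
      iSup₂_le fun η hη => ?_
    simpa only [pow_one] using
      enorm_pow_le (one_le_one_add_natCast_add x y) (hD η (hV hη) x y).2 (k := 1) (by norm_num)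

end RWRE

theorem proposition9 (Θ : Set (RWRE.Param 2)) (hΘ : IsCompact Θ)
    (hsub : Θ ⊆ {θ | 0 < θ 0 ∧ 0 < θ 1 ∧ θ 1 + 1 < θ 0}) :
    ∃ π : RWRE.Param 2 → ℕ → ℝ,
      (∀ θ ∈ Θ, RWRE.IsTheStationaryDist (RWRE.Q RWRE.betaEnv θ) (π θ)) ∧
      RWRE.Differentiability RWRE.betaEnv Θ ∧
      RWRE.Regularity RWRE.betaEnv π Θ ∧
      RWRE.Uniformity RWRE.betaEnv π Θ := by
  refine ⟨RWRE.statDist, fun θ hθ => ?_, fun x y θ hθ => ?_, RWRE.regularity_betaEnv hsub,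
    RWRE.uniformity_betaEnv hsub⟩ <;> obtain ⟨h0, h1, h⟩ := hsub hθ
  · exact RWRE.isTheStationaryDist_statDist h0 h1 h
  · exact RWRE.contDiffAt_phi ⟨h0, h1⟩ x y
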